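/- Let $T$ be a topological monoid (for instance a topological group). A compact semiflow $(T,X)$ is a jointly continuous action $T\times X\to X$, $(t,x)\mapsto tx$, of $T$ on a compact Hausdorff space $X$ (with $ex=x$ and $(st)x=s(tx)$); it is called a flow if $T$ is a group, and it is minimal if $\overline{Tx}=X$ for all $x\in X$. A set $A\subseteq T$ is syndetic if there is a compact $K\subseteq T$ with $Kt\cap A\neq\emptyset$ for all $t\in T$. For an action of $T$ on a topological space $Z$, a point $z\in Z$ is almost periodic (a.p.) if $\{t\in T: tz\in U\}$ is syndetic for every neighbourhood $U$ of $z$; the action is topologically transitive if for all nonempty open $U,V\subseteq Z$ there is $t\in T$ with $V\cap tU\neq\emptyset$; and $(T,Z)$ is an M-semiflow (M-flow if $T$ is a group) if it is topologically transitive and its a.p. points are dense in $Z$. $T$ acts diagonally on $X\times X$. **Theorem.** Let $\pi:X\to Y$ be an extension of minimal compact semiflows, i.e. a continuous surjection with $\pi(tx)=t\pi(x)$ for all $t\in T$, $x\in X$, and put $R_\pi=\{(x_1,x_2)\in X\times X:\pi x_1=\pi x_2\}$. Let $L\subseteq R_\pi$ be a nonempty closed relation on $X$ that is invariant ($tL\subseteq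 L$ for all $t\in T$) and AP-transitive for $\pi$: $L$ is reflexive and symmetric, and whenever $(x_1,x_2),(x_2,x_3)\in L$ are both a.p. points of $(T,X\times X)$, then $(x_1,x_3)\in L$. Let $$RP_{\pi|L}=\{p\in L:\ \exists \text{ nets } p_j\in L,\ t_j\in T \text{ and } z\in X \text{ with } p_j\to p \text{ and } t_jp_j\to(z,z)\}.$$ Suppose that (a) the a.p. points of $(T,L)$ are dense in $L$, and (b) $RP_{\pi|L}=L$. Then $(T,L)$ is topologically transitive; that is, $(T,L)$ is an M-semiflow. In particular, if $T$ is a group, then $(T,L)$ is an M-flow. -/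

import Mathlib

namespace TopDyn

/-- A subset `A` of the monoid `T` is (right) syndetic if there is a compact `K ⊆ T` such that
`K t` meets `A` for every `t ∈ T`. -/
def IsSyndetic {T : Type*} [Monoid T] [TopologicalSpace T] (A : Set T) : Prop :=
  ∃ K : Set T, IsCompact K ∧ ∀ t : T, ∃ k ∈ K, k * t ∈ A

/-- The set `N_T(x, U)` of return times of the point `x` to `U`. -/
def returnTimes (T : Type*) {Z : Type*} [Monoid T] [MulAction T Z] (x : Z) (U : Set Z) : Set T :=
  {t : T | t • x ∈ U}

/-- The hitting times `N_T(U, V) = {t | V ∩ tU ≠ ∅}`. -/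
def hittingTimes (T : Type*) {Z : Type*} [Monoid T] [MulAction T Z] (U V : Set Z) : Set T :=
  {t : T | (V ∩ (fun z : Z => t • z) '' U).Nonempty}

/-- Almost periodic points: the return times to every neighbourhood are syndetic. -/
def IsAPPoint (T : Type*) {Z : Type*} [Monoid T] [TopologicalSpace T] [TopologicalSpace Z]
    [MulAction T Z] (x : Z) : Prop :=
  ∀ U ∈ nhds x, IsSyndetic (returnTimes T x U)

/-- Topological transitivity of the action of `T` on `Z`. -/
def IsTopTransitive (T : Type*) (Z : Type*) [Monoid T] [TopologicalSpace Z]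
    [MulAction T Z] : Prop :=
  ∀ U V : Set Z, IsOpen U → IsOpen V → U.Nonempty → V.Nonempty → (hittingTimes T U V).Nonempty

/-- The almost periodic points of `Z` are dense in `Z`. -/
def HasDenseAPPoints (T : Type*) (Z : Type*) [Monoid T] [TopologicalSpace T] [TopologicalSpace Z]
    [MulAction T Z] : Prop :=
  Dense {z : Z | IsAPPoint T z}

/-- M-semiflows (M-flows if `T` is a group): topologically transitive with a dense set of almost
periodic points. -/
structure IsMSemiflow (T : Type*) (Z : Type*) [Monoid T] [TopologicalSpace T] [TopologicalSpace Z]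
    [MulAction T Z] : Prop where
  topTransitive : IsTopTransitive T Z
  denseAPPoints : HasDenseAPPoints T Z

/-- `π : X → Y` is an extension of (semi)flows: a continuous equivariant surjection. -/
structure IsExtension (T : Type*) {X Y : Type*} [Monoid T] [TopologicalSpace X]
    [TopologicalSpace Y] [MulAction T X] [MulAction T Y] (π : X → Y) : Prop where
  continuous : Continuous π
  surjective : Function.Surjective π
  map_smul : ∀ (t : T) (x : X), π (t • x) = t • π x

/-- The relation `R_π = {(x₁, x₂) | π x₁ = π x₂}`. -/
def fiberRel {X Y : Type*} (π : X → Y) : Set (X × X) :=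
  {p : X × X | π p.1 = π p.2}

/-- AP-transitive relations for `π`: nonempty, reflexive, symmetric relations inside `R_π` which
are transitive along pairs that are almost periodic points of `X × X` (with the diagonal
action). -/
structure IsAPTransitive (T : Type*) {X Y : Type*} [Monoid T] [TopologicalSpace T]
    [TopologicalSpace X] [MulAction T X] (π : X → Y) (L : Set (X × X)) : Prop where
  nonempty : L.Nonempty
  subset_fiberRel : L ⊆ fiberRel π
  refl : ∀ x : X, (x, x) ∈ L
  symm : ∀ x₁ x₂ : X, (x₁, x₂) ∈ L → (x₂, x₁) ∈ L
  trans_of_ap : ∀ x₁ x₂ x₃ : X, (x₁, x₂) ∈ L → (x₂, x₃) ∈ L →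
    IsAPPoint T (x₁, x₂) → IsAPPoint T (x₂, x₃) → (x₁, x₃) ∈ L

/-- The regionally proximal relation relative to `L`: the pairs `p ∈ L` for which there are nets
`pⱼ ∈ L`, `tⱼ ∈ T` and a diagonal point `(z, z)` such that `pⱼ → p` and `tⱼ pⱼ → (z, z)`.
The existence of such nets is written as membership of `(p, (z, z))` in the closure of the set of
all `(q, t q)` with `q ∈ L`, `t ∈ T`. -/
def regionallyProximal (T : Type*) {X : Type*} [Monoid T] [TopologicalSpace X] [MulAction T X]
    (L : Set (X × X)) : Set (X × X) :=
  {p : X × X | p ∈ L ∧ ∃ z : X,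
    (p, (z, z)) ∈ closure {w : (X × X) × (X × X) | ∃ q ∈ L, ∃ t : T, w = (q, t • q)}}

end TopDyn

namespace TopDyn

open MulAction Set Filter Topology

/-! ### Minimal sets and almost periodic points -/

section MinimalSets

/-! By density, transitivity reduces to a.p. pairs `(a, b) ∈ O` and `(x, y) ∈ O'` of `L`: it
suffices that `(x, y)` lies in the closure `W` of the orbits issuing from `L ∩ O`. An element of a
minimal left ideal `I` of the enveloping semigroup moves `(x, y)` to some `(a, c)`, with `a, b, c`
fixed by one idempotent `u ∈ I`. Since `(x, y)` is a.p., it lies in the orbit closure of `(a, c)`,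
so `(a, c) ∈ W` is enough.

AP-transitivity gives `(b, c) ∈ L`, so this pair is regionally proximal: a.p. pairs `(b', c') ∈ L`
near `(b, c)` have translates near a diagonal point. Elements of `I` carry `(a, b)` to a.p. pairs
`(a', b')`, and AP-transitivity puts `(a', c')` in `L`. The translates of `b'` and `c'` share a
limit, so those of `(a', c')` tend to a point of the orbit closure of `(a, b)`, from which
minimality leads back into `O`. Hence `(a', c') ∈ W` eventually; passing to the limit and applying
`u` yields `(a, c) ∈ W`. This is `pair_mem_of_regionallyProximal`. -/

theorem smul_mem_orbit_of_mem {T Z : Type*} [Monoid T] [MulAction T Z] (t : T)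
    {x y : Z} (hy : y ∈ orbit T x) : t • y ∈ orbit T x := by
  obtain ⟨s, rfl⟩ := hy
  exact ⟨t * s, mul_smul t s x⟩

variable {T Z Z' : Type*} [Monoid T] [TopologicalSpace Z] [MulAction T Z]
  [TopologicalSpace Z'] [MulAction T Z']

theorem closure_orbit_subset {C : Set Z} (hC : IsClosed C) (hinv : ∀ (t : T), ∀ x ∈ C, t • x ∈ C)
    {x : Z} (hx : x ∈ C) : closure (orbit T x) ⊆ C := by
  refine closure_minimal ?_ hC
  rintro _ ⟨t, rfl⟩
  exact hinv t x hx

theorem smul_mem_closure [ContinuousConstSMul T Z] {C : Set Z} (hinv : ∀ (t : T), ∀ x ∈ C, t • x ∈ C)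
    (t : T) {x : Z} (hx : x ∈ closure C) : t • x ∈ closure C :=
  map_mem_closure (continuous_const_smul t) hx (hinv t)

theorem smul_mem_closure_orbit [ContinuousConstSMul T Z] (t : T) {x y : Z}
    (hy : y ∈ closure (orbit T x)) : t • y ∈ closure (orbit T x) :=
  smul_mem_closure (fun s _ h => smul_mem_orbit_of_mem s h) t hy

/-- Minimal sets of an action: nonempty closed invariant sets in which every orbit is dense. -/
structure IsMinimalSet (T : Type*) {Z : Type*} [Monoid T] [TopologicalSpace Z] [MulAction T Z]
    (M : Set Z) : Prop where
  isClosed : IsClosed M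
  nonempty : M.Nonempty
  smul_mem : ∀ (t : T), ∀ x ∈ M, t • x ∈ M
  subset_closure_orbit : ∀ x ∈ M, M ⊆ closure (orbit T x)

theorem IsMinimalSet.subset_of_mem {M C : Set Z} (hM : IsMinimalSet T M) (hC : IsClosed C)
    (hinv : ∀ (t : T), ∀ x ∈ C, t • x ∈ C) {x : Z} (hxM : x ∈ M) (hxC : x ∈ C) : M ⊆ C :=
  (hM.subset_closure_orbit x hxM).trans (closure_orbit_subset hC hinv hxC)

theorem exists_isMinimalSet_subset [CompactSpace Z] [ContinuousConstSMul T Z] {C : Set Z}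
    (hC : IsClosed C) (hne : C.Nonempty) (hinv : ∀ (t : T), ∀ x ∈ C, t • x ∈ C) :
    ∃ M ⊆ C, IsMinimalSet T M := by
  let S : Set (Set Z) := {N | IsClosed N ∧ N.Nonempty ∧ ∀ (t : T), ∀ x ∈ N, t • x ∈ N}
  obtain ⟨M, hMC, hM⟩ := zorn_superset_nonempty S (fun c hcS hc hcne => by
    refine ⟨⋂₀ c, ⟨isClosed_sInter fun N hN => (hcS hN).1, ?_, ?_⟩,
      fun N hN => sInter_subset_of_mem hN⟩
    · have : Nonempty c := hcne.to_subtype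
      exact IsCompact.nonempty_sInter_of_directed_nonempty_isCompact_isClosed
        (IsChain.directedOn hc.symm) (fun N hN => (hcS hN).2.1)
        (fun N hN => (hcS hN).1.isCompact) (fun N hN => (hcS hN).1)
    · exact fun t x hx N hN => (hcS hN).2.2 t x (hx N hN)) C ⟨hC, hne, hinv⟩
  refine ⟨M, hMC, hM.prop.1, hM.prop.2.1, hM.prop.2.2, fun x hx => ?_⟩
  exact hM.le_of_le
    (show closure (orbit T x) ∈ S from ⟨isClosed_closure, ⟨x, subset_closure (mem_orbit_self x)⟩,
      fun t y hy => smul_mem_closure_orbit t hy⟩)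
    (closure_orbit_subset hM.prop.1 hM.prop.2.2 hx)

theorem IsMinimalSet.image [CompactSpace Z] [T2Space Z'] {M : Set Z} (hM : IsMinimalSet T M)
    {φ : Z → Z'} (hφ : Continuous φ) (hsmul : ∀ (t : T) (z : Z), φ (t • z) = t • φ z) :
    IsMinimalSet T (φ '' M) where
  isClosed := (hM.isClosed.isCompact.image hφ).isClosed
  nonempty := hM.nonempty.image φ
  smul_mem := by
    rintro t _ ⟨x, hx, rfl⟩
    exact ⟨t • x, hM.smul_mem t x hx, hsmul t x⟩
  subset_closure_orbit := by
    rintro _ ⟨x, hx, rfl⟩ _ ⟨y, hy, rfl⟩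
    refine map_mem_closure hφ (hM.subset_closure_orbit x hx hy) ?_
    rintro _ ⟨t, rfl⟩
    exact ⟨t, (hsmul t x).symm⟩

/-- Points of compact minimal sets are almost periodic. -/
theorem IsMinimalSet.isAPPoint [TopologicalSpace T] [CompactSpace Z] [ContinuousConstSMul T Z]
    {M : Set Z} (hM : IsMinimalSet T M) {x : Z} (hx : x ∈ M) : IsAPPoint T x := by
  intro U hU
  obtain ⟨O, hOU, hO, hxO⟩ := mem_nhds_iff.1 hU
  obtain ⟨F, hF⟩ := hM.isClosed.isCompact.elim_finite_subcover
    (fun t : T => (fun z : Z => t • z) ⁻¹' O) (fun t => hO.preimage (continuous_const_smul t))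
    (fun y hy => by
      obtain ⟨_, hzO, t, rfl⟩ := mem_closure_iff.1 (hM.subset_closure_orbit y hy hx) O hO hxO
      exact mem_iUnion.2 ⟨t, hzO⟩)
  refine ⟨F, F.finite_toSet.isCompact, fun t => ?_⟩
  obtain ⟨k, hk, hkt⟩ := mem_iUnion₂.1 (hF (hM.smul_mem t x hx))
  refine ⟨k, hk, hOU ?_⟩
  rw [mul_smul]
  exact hkt

/-- An almost periodic point lies in the orbit closure of each point of its orbit closure. -/
theorem IsAPPoint.mem_closure_orbit [TopologicalSpace T] [RegularSpace Z] [ContinuousSMul T Z]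
    {x y : Z} (hx : IsAPPoint T x) (hy : y ∈ closure (orbit T x)) : x ∈ closure (orbit T y) := by
  refine (mem_closure_iff_nhds_basis (closed_nhds_basis x)).2 fun U ⟨hU, hUc⟩ => ?_
  obtain ⟨K, hK, hKU⟩ := hx U hU
  by_contra! hcon
  -- The compact set `K` moves a whole neighbourhood `B` of `y` off `U`; but the orbit of `x` enters
  -- `B`, and from there some `k ∈ K` brings it into `U`.
  obtain ⟨A, B, -, hB, hKA, hyB, hAB⟩ := generalized_tube_lemma hK (isCompact_singleton (x := y))
    (hUc.isOpen_compl.preimage (continuous_smul (M := T) (X := Z))) (by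
      rintro ⟨k, z⟩ ⟨-, rfl⟩
      exact hcon _ ⟨k, rfl⟩)
  obtain ⟨_, hzB, t, rfl⟩ := mem_closure_iff.1 hy B hB (hyB rfl)
  obtain ⟨k, hk, hkt⟩ := hKU t
  refine hAB (show (k, t • x) ∈ A ×ˢ B from ⟨hKA hk, hzB⟩) ?_
  rw [returnTimes, mem_ofPred_eq, mul_smul] at hkt
  exact hkt

theorem IsAPPoint.isMinimalSet [TopologicalSpace T] [RegularSpace Z] [ContinuousSMul T Z]
    {x : Z} (hx : IsAPPoint T x) : IsMinimalSet T (closure (orbit T x)) where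
  isClosed := isClosed_closure
  nonempty := ⟨x, subset_closure (mem_orbit_self x)⟩
  smul_mem t _ hy := smul_mem_closure_orbit t hy
  subset_closure_orbit _ hy := closure_orbit_subset isClosed_closure
    (fun t _ h => smul_mem_closure_orbit t h) (hx.mem_closure_orbit hy)

theorem IsAPPoint.map [TopologicalSpace T] {φ : Z → Z'} (hφ : Continuous φ)
    (hsmul : ∀ (t : T) (z : Z), φ (t • z) = t • φ z) {x : Z} (hx : IsAPPoint T x) :
    IsAPPoint T (φ x) := by
  intro U hU
  obtain ⟨K, hK, hKU⟩ := hx (φ ⁻¹' U) (hφ.continuousAt hU)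
  refine ⟨K, hK, fun t => ?_⟩
  obtain ⟨k, hk, hkt⟩ := hKU t
  refine ⟨k, hk, ?_⟩
  rw [returnTimes, mem_ofPred_eq, ← hsmul]
  exact hkt

end MinimalSets

/-! ### Enveloping semigroup, minimal left ideals and idempotents -/

section Enveloping

variable (T X : Type*) [Monoid T] [TopologicalSpace X] [MulAction T X]

/-- The enveloping semigroup: the pointwise closure of the translations of `X`. -/
def enveloping : Set (X → X) := closure (orbit T (id : X → X))

/-- Minimal left ideals of the enveloping semigroup, as minimal sets of `T` acting on `X → X`. -/
structure IsMinimalLeftIdeal (I : Set (X → X)) : Prop extends IsMinimalSet T I where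
  subset_enveloping : I ⊆ enveloping T X

variable {T X}

/-- The preimage of `C` is closed, invariant and contains `id`. Used for right compositions and for
evaluation at a pair. -/
theorem map_mem_of_mem_enveloping {Z : Type*} [TopologicalSpace Z] [MulAction T Z]
    {φ : (X → X) → Z} (hφ : Continuous φ) (hsmul : ∀ (t : T) (f : X → X), φ (t • f) = t • φ f)
    {C : Set Z} (hC : IsClosed C) (hinv : ∀ (t : T), ∀ x ∈ C, t • x ∈ C) (hid : φ id ∈ C)
    {f : X → X} (hf : f ∈ enveloping T X) : φ f ∈ C :=
  closure_orbit_subset (C := φ ⁻¹' C) (hC.preimage hφ)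
    (fun t g hg => by rw [mem_preimage, hsmul]; exact hinv t _ hg) hid hf

theorem continuous_comp_right (g : X → X) : Continuous fun f : X → X => f ∘ g :=
  continuous_pi fun x => continuous_apply (g x)

theorem continuous_eval_pair (a b : X) : Continuous fun f : X → X => (f a, f b) :=
  (continuous_apply a).prodMk (continuous_apply b)

theorem pair_mem_of_mem_enveloping {C : Set (X × X)} (hC : IsClosed C)
    (hinv : ∀ (t : T), ∀ x ∈ C, t • x ∈ C) {a b : X} (hab : (a, b) ∈ C)
    {f : X → X} (hf : f ∈ enveloping T X) : (f a, f b) ∈ C :=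
  map_mem_of_mem_enveloping (continuous_eval_pair a b) (fun _ _ => rfl) hC hinv hab hf

theorem exists_isMinimalLeftIdeal [CompactSpace X] [ContinuousConstSMul T X] :
    ∃ I : Set (X → X), IsMinimalLeftIdeal T X I := by
  obtain ⟨I, hIE, hI⟩ := exists_isMinimalSet_subset (T := T) (C := enveloping T X)
    isClosed_closure ⟨id, subset_closure (mem_orbit_self _)⟩
    (fun t _ h => smul_mem_closure_orbit t h)
  exact ⟨I, hI, hIE⟩

namespace IsMinimalLeftIdeal

variable {I : Set (X → X)}

theorem comp_mem (hI : IsMinimalLeftIdeal T X I) {f g : X → X} (hf : f ∈ enveloping T X)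
    (hg : g ∈ I) : f ∘ g ∈ I :=
  map_mem_of_mem_enveloping (continuous_comp_right g) (fun _ _ => rfl) hI.isClosed hI.smul_mem
    hg hf

/-- The set `I ∘ f` is closed, invariant and meets `I`, so minimality forces `I ⊆ I ∘ f`. -/
theorem exists_comp_eq [CompactSpace X] [T2Space X] (hI : IsMinimalLeftIdeal T X I)
    {f g : X → X} (hf : f ∈ I) (hg : g ∈ I) : ∃ r ∈ I, r ∘ f = g := by
  have him := hI.toIsMinimalSet.image (continuous_comp_right f) (fun _ _ => rfl)
  exact hI.subset_of_mem him.isClosed him.smul_mem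
    (hI.comp_mem (hI.subset_enveloping hf) hf) (mem_image_of_mem _ hf) hg

/-- Idempotents of a minimal left ideal are right identities. -/
theorem comp_eq_self [CompactSpace X] [T2Space X] (hI : IsMinimalLeftIdeal T X I)
    {f v : X → X} (hf : f ∈ I) (hv : v ∈ I) (hvv : v ∘ v = v) : f ∘ v = f := by
  obtain ⟨r, -, rfl⟩ := hI.exists_comp_eq hv hf
  rw [Function.comp_assoc, hvv]

theorem exists_apply_eq [CompactSpace X] [T2Space X] (hI : IsMinimalLeftIdeal T X I)
    (hX : IsMinimal T X) (a b : X) : ∃ f ∈ I, f a = b := by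
  have him := hI.toIsMinimalSet.image (continuous_apply a) (fun _ _ => rfl)
  obtain ⟨x, hx⟩ := him.nonempty
  exact closure_orbit_subset him.isClosed him.smul_mem hx (hX.dense_orbit x b)

theorem isAPPoint_pair [TopologicalSpace T] [CompactSpace X] [ContinuousConstSMul T X]
    (hI : IsMinimalLeftIdeal T X I) {f : X → X} (hf : f ∈ I) (a b : X) :
    IsAPPoint T (f a, f b) :=
  (hI.isAPPoint hf).map (continuous_eval_pair a b) (fun _ _ => rfl)

/-- An almost periodic pair is fixed by an idempotent of any given minimal left ideal. -/
theorem exists_idempotent_apply_eq [TopologicalSpace T] [CompactSpace X] [T2Space X]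
    [ContinuousSMul T X] (hI : IsMinimalLeftIdeal T X I) {a b : X} (hab : IsAPPoint T (a, b)) :
    ∃ u ∈ I, u ∘ u = u ∧ u a = a ∧ u b = b := by
  have him := hI.toIsMinimalSet.image (continuous_eval_pair a b) (fun _ _ => rfl)
  obtain ⟨f, hf⟩ := hI.nonempty
  have hmem : (f a, f b) ∈ closure (orbit T (a, b)) :=
    pair_mem_of_mem_enveloping isClosed_closure (fun t _ h => smul_mem_closure_orbit t h)
      (subset_closure (mem_orbit_self _)) (hI.subset_enveloping hf)
  obtain ⟨g, hg, hgab⟩ := hab.isMinimalSet.subset_of_mem him.isClosed him.smul_mem hmem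
    (mem_image_of_mem _ hf) (subset_closure (mem_orbit_self _))
  -- The elements of `I` fixing `a` and `b` form a nonempty compact semigroup under composition,
  -- which contains an idempotent by Ellis's lemma.
  let _ : Semigroup (X → X) := { mul := fun f g => f ∘ g, mul_assoc := fun _ _ _ => rfl }
  obtain ⟨u, ⟨huI, huab⟩, huu⟩ := exists_idempotent_in_compact_subsemigroup
    (M := X → X) continuous_comp_right (I ∩ (fun f : X → X => (f a, f b)) ⁻¹' {(a, b)})
    ⟨g, hg, hgab⟩
    (hI.isClosed.inter (isClosed_singleton.preimage (continuous_eval_pair a b))).isCompact (by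
      rintro p ⟨hp, hpab⟩ q ⟨hq, hqab⟩
      refine ⟨hI.comp_mem (hI.subset_enveloping hp) hq, ?_⟩
      simp only [mem_preimage, mem_singleton_iff, Prod.mk.injEq] at hpab hqab ⊢
      change p (q a) = a ∧ p (q b) = b
      rw [hqab.1, hqab.2]
      exact hpab)
  simp only [mem_preimage, mem_singleton_iff, Prod.mk.injEq] at huab
  exact ⟨u, huI, huu, huab⟩

end IsMinimalLeftIdeal

end Enveloping

/-! ### Regional proximality and transitivity -/

section Transitivity

/-- In the definition of the regionally proximal relation of a closed invariant relation with
dense almost periodic points, the approximating pairs may be taken almost periodic. -/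
theorem mem_closure_ap_of_mem_regionallyProximal {T X : Type*} [Monoid T]
    [TopologicalSpace T] [TopologicalSpace X] [MulAction T X] [ContinuousConstSMul T X]
    {L : Set (X × X)}
    (hd : L ⊆ closure {q | q ∈ L ∧ IsAPPoint T q}) {p : X × X}
    (hp : p ∈ regionallyProximal T L) : ∃ z : X, (p, (z, z)) ∈
      closure {w : (X × X) × (X × X) | (w.1 ∈ L ∧ IsAPPoint T w.1) ∧ ∃ t : T, w.2 = t • w.1} := by
  obtain ⟨-, z, hz⟩ := hp
  refine ⟨z, closure_minimal ?_ isClosed_closure hz⟩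
  rintro _ ⟨q, hq, t, rfl⟩
  exact map_mem_closure (f := fun q : X × X => (q, t • q))
    (continuous_id.prodMk (continuous_const_smul t)) (hd hq) fun q' hq' => ⟨hq', t, rfl⟩

variable {T X : Type*} [Monoid T] [TopologicalSpace T] [TopologicalSpace X] [CompactSpace X]
  [T2Space X] [MulAction T X] [ContinuousSMul T X]

/-- The key step towards transitivity: if `(a, b)` and `(b, c)` are pairs of `L` fixed by a common
minimal idempotent and `(b, c)` is regionally proximal, then `(a, c)` lies in each closed invariant
set containing all pairs of `L` whose orbit meets a given open neighbourhood of `(a, b)`. -/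
theorem pair_mem_of_regionallyProximal (hX : IsMinimal T X) {L : Set (X × X)}
    (hLc : IsClosed L) (hLinv : ∀ (t : T), ∀ q ∈ L, t • q ∈ L)
    (htrans : ∀ x₁ x₂ x₃ : X, (x₁, x₂) ∈ L → (x₂, x₃) ∈ L →
      IsAPPoint T (x₁, x₂) → IsAPPoint T (x₂, x₃) → (x₁, x₃) ∈ L)
    (hd : L ⊆ closure {q | q ∈ L ∧ IsAPPoint T q})
    {I : Set (X → X)} (hI : IsMinimalLeftIdeal T X I) {u : X → X} (hu : u ∈ I) (huu : u ∘ u = u)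
    {a b c : X} (hua : u a = a) (hub : u b = b) (huc : u c = c) (hab : (a, b) ∈ L)
    (hbc : (b, c) ∈ regionallyProximal T L)
    {O : Set (X × X)} (hO : IsOpen O) (habO : (a, b) ∈ O)
    {W : Set (X × X)} (hW : IsClosed W) (hWinv : ∀ (t : T), ∀ q ∈ W, t • q ∈ W)
    (hOW : ∀ q ∈ L, ∀ t : T, t • q ∈ O → q ∈ W) : (a, c) ∈ W := by
  obtain ⟨z, hz⟩ := mem_closure_ap_of_mem_regionallyProximal hd hbc
  obtain ⟨G, hGS, hG⟩ := mem_closure_iff_ultrafilter.1 hz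
  have hlim : Tendsto (fun w : (X × X) × (X × X) => w) G (𝓝 ((b, c), (z, z))) := hG
  -- The value `1` is a dummy, used only off the set that carries `G`.
  have hτ : ∀ w : (X × X) × (X × X), ∃ t : T, (∃ t : T, w.2 = t • w.1) → w.2 = t • w.1 := by
    intro w
    by_cases h : ∃ t : T, w.2 = t • w.1
    · exact ⟨h.choose, fun _ => h.choose_spec⟩
    · exact ⟨1, fun h' => absurd h' h⟩
  choose τ hτ using hτ
  choose P hPI hPb using hI.exists_apply_eq hX b
  obtain ⟨p, hpI, hp⟩ := hI.isClosed.isCompact.ultrafilter_le_nhds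
    (G.map fun w => P w.1.1) (by
      rw [le_principal_iff]
      exact Ultrafilter.mem_map.2 (Filter.univ_mem' fun w => hPI w.1.1))
  replace hp : Tendsto (fun w : (X × X) × (X × X) => P w.1.1) G (𝓝 p) := hp
  have hlim₁ : Tendsto (fun w : (X × X) × (X × X) => w.1) G (𝓝 (b, c)) :=
    (continuous_fst.tendsto _).comp hlim
  have hlim₂ : Tendsto (fun w : (X × X) × (X × X) => w.2) G (𝓝 (z, z)) :=
    (continuous_snd.tendsto _).comp hlim
  have hpb : p b = b := by
    refine tendsto_nhds_unique (((continuous_apply b).tendsto p).comp hp) ?_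
    simpa only [Function.comp_def, hPb] using (continuous_fst.tendsto _).comp hlim₁
  -- correct `p` by an inverse `r` of `u ∘ p`
  obtain ⟨r', hr'I, hr'⟩ := hI.exists_comp_eq hpI hu
  obtain ⟨r, hrI, hrp, hur⟩ : ∃ r ∈ I, r ∘ p = u ∧ u ∘ r = r :=
    ⟨u ∘ r', hI.comp_mem (hI.subset_enveloping hu) hr'I,
      by rw [Function.comp_assoc, hr', huu], by rw [← Function.comp_assoc, huu]⟩
  have hrb : r b = b := by
    have := congrFun hrp b
    rwa [Function.comp_apply, hpb, hub] at this
  have hvI : p ∘ r ∈ I := hI.comp_mem (hI.subset_enveloping hpI) hrI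
  have hvv : (p ∘ r) ∘ (p ∘ r) = p ∘ r := by
    rw [Function.comp_assoc, ← Function.comp_assoc r, hrp, hur]
  -- The idempotent `p ∘ r` of `I` is a right identity, so `u ∘ (p ∘ r) = u`.
  have huv : u (p (r a)) = a := by
    have := congrFun (hI.comp_eq_self hu hvI hvv) a
    rwa [hua] at this
  -- the limit of the translates
  have hQI : ∀ w : (X × X) × (X × X), τ w • (P w.1.1 ∘ r) ∈ I := fun w =>
    hI.smul_mem _ _ (hI.comp_mem (hI.subset_enveloping (hPI _)) hrI)
  obtain ⟨q, hqI, hq⟩ := hI.isClosed.isCompact.ultrafilter_le_nhds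
    (G.map fun w => τ w • (P w.1.1 ∘ r)) (by
      rw [le_principal_iff]
      exact Ultrafilter.mem_map.2 (Filter.univ_mem' hQI))
  replace hq : Tendsto (fun w : (X × X) × (X × X) => τ w • (P w.1.1 ∘ r)) G (𝓝 q) := hq
  have hτG : ∀ᶠ w in (G : Filter ((X × X) × (X × X))), w.2 = τ w • w.1 := by
    filter_upwards [hGS] with w hw using hτ w hw.2
  have hqb : q b = z := by
    refine tendsto_nhds_unique (((continuous_apply b).tendsto q).comp hq) ?_
    refine ((continuous_fst.tendsto _).comp hlim₂).congr' ?_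
    filter_upwards [hτG] with w hw
    simp only [Function.comp_apply, Pi.smul_apply, hrb, hPb]
    rw [hw, Prod.smul_fst]
  obtain ⟨s, hsI, hsq⟩ := hI.exists_comp_eq hqI hu
  -- Since `s ∘ q = u`, the pair `(q a, z) = (q a, q b)` has `(a, b)` in its orbit closure.
  obtain ⟨t, ht⟩ : ∃ t : T, t • (q a, z) ∈ O := by
    have hmem : (s (q a), s (q b)) ∈ closure (orbit T (q a, q b)) :=
      pair_mem_of_mem_enveloping isClosed_closure (fun t _ h => smul_mem_closure_orbit t h)
        (subset_closure (mem_orbit_self _)) (hI.subset_enveloping hsI)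
    have hsa : s (q a) = a := (congrFun hsq a).trans hua
    have hsb : s (q b) = b := (congrFun hsq b).trans hub
    rw [hsa, hsb, hqb] at hmem
    obtain ⟨_, hxO, t, rfl⟩ := mem_closure_iff.1 hmem O hO habO
    exact ⟨t, hxO⟩
  have hev : Tendsto (fun w : (X × X) × (X × X) => t • τ w • (P w.1.1 (r a), w.1.2)) G
      (𝓝 (t • (q a, z))) := by
    refine ((continuous_const_smul t).tendsto _).comp ?_
    refine (((continuous_apply a).tendsto q).comp hq).prodMk_nhds ?_
    refine ((continuous_snd.tendsto _).comp hlim₂).congr' ?_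
    filter_upwards [hτG] with w hw
    simp only [Function.comp_apply]
    rw [hw, Prod.smul_snd]
  -- `P w.1.1 ∘ r` sends `b` to `w.1.1`, the middle point for AP-transitivity.
  have hmemW : ∀ᶠ w in (G : Filter ((X × X) × (X × X))), (P w.1.1 (r a), w.1.2) ∈ W := by
    filter_upwards [hev (hO.mem_nhds ht), hGS] with w hwO hwS
    refine hOW _ ?_ (t * τ w) (by rw [mul_smul]; exact hwO)
    have hPr : P w.1.1 ∘ r ∈ I := hI.comp_mem (hI.subset_enveloping (hPI _)) hrI
    have h₁ := pair_mem_of_mem_enveloping hLc hLinv hab (hI.subset_enveloping hPr)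
    have h₂ := hI.isAPPoint_pair hPr a b
    simp only [Function.comp_apply, hrb, hPb] at h₁ h₂
    exact htrans _ _ _ h₁ hwS.1.1 h₂ hwS.1.2
  have hvc : (p (r a), c) ∈ W := by
    refine hW.mem_of_tendsto (Tendsto.prodMk_nhds ?_ ?_) hmemW
    · exact ((continuous_apply (r a)).tendsto p).comp hp
    · exact (continuous_snd.tendsto _).comp hlim₁
  have := pair_mem_of_mem_enveloping hW hWinv hvc (hI.subset_enveloping hu)
  rwa [huv, huc] at this

end Transitivity

end TopDyn

theorem theorem2p2 {T X Y : Type*} [Monoid T] [TopologicalSpace T] [ContinuousMul T]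
    [TopologicalSpace X] [CompactSpace X] [T2Space X] [MulAction T X] [ContinuousSMul T X]
    [TopologicalSpace Y] [CompactSpace Y] [T2Space Y] [MulAction T Y] [ContinuousSMul T Y]
    (hX : MulAction.IsMinimal T X) (hY : MulAction.IsMinimal T Y)
    (π : X → Y) (hπ : TopDyn.IsExtension T π)
    (L : SubMulAction T (X × X)) (hLclosed : IsClosed (L : Set (X × X)))
    (hLap : TopDyn.IsAPTransitive T π (L : Set (X × X)))
    (ha : TopDyn.HasDenseAPPoints T L)
    (hb : TopDyn.regionallyProximal T (L : Set (X × X)) = (L : Set (X × X))) :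
    TopDyn.IsMSemiflow T L := by
  refine ⟨?_, ha⟩
  have hLinv : ∀ (t : T), ∀ q ∈ (L : Set (X × X)), t • q ∈ (L : Set (X × X)) :=
    fun t q hq => L.smul_mem t hq
  have hd : (L : Set (X × X)) ⊆ closure {q | q ∈ (L : Set (X × X)) ∧ TopDyn.IsAPPoint T q} :=
    fun q hq => map_mem_closure continuous_subtype_val (ha ⟨q, hq⟩) fun q' hq' =>
      ⟨q'.2, TopDyn.IsAPPoint.map continuous_subtype_val (fun _ _ => rfl) hq'⟩
  rintro _ _ ⟨O, hO, rfl⟩ ⟨O', hO', rfl⟩ ⟨q₁, hq₁⟩ ⟨q₂, hq₂⟩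
  obtain ⟨⟨a, b⟩, habO, hab, habAP⟩ := mem_closure_iff.1 (hd q₁.2) O hO hq₁
  obtain ⟨⟨x, y⟩, hxyO', hxy, hxyAP⟩ := mem_closure_iff.1 (hd q₂.2) O' hO' hq₂
  let W₀ : Set (X × X) := {w | ∃ q ∈ L, q ∈ O ∧ w ∈ MulAction.orbit T q}
  have hW₀ : ∀ (t : T), ∀ w ∈ W₀, t • w ∈ W₀ := by
    rintro t w ⟨q, hq, hqO, hw⟩
    exact ⟨q, hq, hqO, TopDyn.smul_mem_orbit_of_mem t hw⟩
  have hWinv : ∀ (t : T), ∀ w ∈ closure W₀, t • w ∈ closure W₀ :=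
    fun t _ hw => TopDyn.smul_mem_closure hW₀ t hw
  suffices hxyW : (x, y) ∈ closure W₀ by
    obtain ⟨_, hwO', q, hq, hqO, t, rfl⟩ := mem_closure_iff.1 hxyW O' hO' hxyO'
    exact ⟨t, t • ⟨q, hq⟩, hwO', ⟨q, hq⟩, hqO, rfl⟩
  -- As `t` need not be invertible, `q` is approximated by a.p. points, each lying in the orbit
  -- closure of its own translate by `t`.
  have hOW : ∀ q ∈ (L : Set (X × X)), ∀ t : T, t • q ∈ O → q ∈ closure W₀ := by
    intro q hq t htq
    rw [← closure_closure, mem_closure_iff]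
    intro N hN hqN
    obtain ⟨q', ⟨hq'N, hq'O⟩, hq', hq'AP⟩ := mem_closure_iff.1 (hd hq)
      (N ∩ (fun w => t • w) ⁻¹' O) (hN.inter (hO.preimage (continuous_const_smul t))) ⟨hqN, htq⟩
    refine ⟨q', hq'N, closure_mono ?_ (hq'AP.mem_closure_orbit (y := t • q')
      (subset_closure ⟨t, rfl⟩))⟩
    exact fun w hw => ⟨t • q', hLinv t q' hq', hq'O, hw⟩
  obtain ⟨I, hI⟩ := TopDyn.exists_isMinimalLeftIdeal (T := T) (X := X)
  obtain ⟨u, hu, huu, hua, hub⟩ := hI.exists_idempotent_apply_eq habAP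
  obtain ⟨r, hr, hrx⟩ := hI.exists_apply_eq hX x a
  have hurI : u ∘ r ∈ I := hI.comp_mem (hI.subset_enveloping hu) hr
  have hur : u (r x) = a := by rw [hrx, hua]
  have hac : (a, u (r y)) ∈ (L : Set (X × X)) := by
    have := TopDyn.pair_mem_of_mem_enveloping hLclosed hLinv hxy (hI.subset_enveloping hurI)
    rwa [Function.comp_apply, hur] at this
  have hacAP : TopDyn.IsAPPoint T (a, u (r y)) := by
    have := hI.isAPPoint_pair hurI x y
    rwa [Function.comp_apply, hur] at this
  have hbaAP : TopDyn.IsAPPoint T (b, a) := by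
    have := hI.isAPPoint_pair hu b a
    rwa [hua, hub] at this
  have hbc : (b, u (r y)) ∈ (L : Set (X × X)) :=
    hLap.trans_of_ap _ _ _ (hLap.symm _ _ hab) hac hbaAP hacAP
  have hacW : (a, u (r y)) ∈ closure W₀ :=
    TopDyn.pair_mem_of_regionallyProximal hX hLclosed hLinv hLap.trans_of_ap hd hI hu huu hua hub
      (congrFun huu (r y)) hab (by rw [hb]; exact hbc) hO habO isClosed_closure hWinv hOW
  have hacxy : (a, u (r y)) ∈ closure (MulAction.orbit T (x, y)) := by
    have := TopDyn.pair_mem_of_mem_enveloping (T := T) (a := x) (b := y) isClosed_closure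
      (fun t _ h => TopDyn.smul_mem_closure_orbit t h)
      (subset_closure (MulAction.mem_orbit_self (x, y))) (hI.subset_enveloping hurI)
    rwa [Function.comp_apply, hur] at this
  exact TopDyn.closure_orbit_subset isClosed_closure hWinv hacW (hxyAP.mem_closure_orbit hacxy)
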